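/- Let $k$ be a field of any characteristic, $V$ a finite-dimensional $k$-vector space, $d\ge 2$, and let $f\in k[V]$ be homogeneous of degree $d$ (varieties and codimensions are understood scheme-theoretically over $k$, not through $k$-points, and $\operatorname{codim}\emptyset=\infty$). Let $f^{(2,d-2)}(v,x)$ be the component of bidegree $(2,d-2)$ of the polynomial $f(v+x)$ on $V\times V$, let $H_f(x)$ be the Hessian form of $f$ at $x$ (the bilinear form on $V$ given by the second partial derivatives of $f$), and set $$Z^{\mathrm{sym}}_f=\{(v,x)\in V\times V : v\in\ker H_f(x)\},\qquad g_{\mathrm{sym}}(f)=\operatorname{codim}_{V\times V}Z^{\mathrm{sym}}_f .$$ For a polynomial $F$, let $\mathrm{Sing}(F=0)$ be the locus $F=0,\ dF=0$, and let $S(F)\supseteq \mathrm{Sing}(F=0)$ be the locus $dF=0$. Put $c(f)=\operatorname{codim}_V\mathrm{Sing}(f=0)$ and $c'(f)=\operatorname{codim}_V S(f)$, so that $c'(f)\le c(f)$, with equality if $\mathrm{char}(k)\nmid d$. (i) $Z^{\mathrm{sym}}_f$ contains the singular locus of $f^{(2,d-2)}(v,x)=0$, and even contains $S(f^{(2,d-2)})$.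 (ii) $g_{\mathrm{sym}}(f)\le (d+1)\,c(f)$, and even $g_{\mathrm{sym}}(f)\le (d+1)\,c'(f)$. If $d$ is odd and $\mathrm{char}(k)\ne 2$, then $g_{\mathrm{sym}}(f)\le d\,c(f)$, and even $g_{\mathrm{sym}}(f)\le d\,c'(f)$. (iii) If $\mathrm{char}(k)$ does not divide $d-1$, then $c'(f)\le g_{\mathrm{sym}}(f)$; if in addition $\mathrm{char}(k)$ does not divide $d$, then $c(f)\le g_{\mathrm{sym}}(f)$. -/

import Mathlib

noncomputable section

namespace SymGeom

open MvPolynomial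

variable {k : Type*} [Field k] {σ : Type*}

/-- The affine space with coordinate set `σ` over `k` is the prime spectrum of `k[σ]`, so that its
points include the non-closed points and the points over extensions of `k`. The codimension of
a (closed) subset is the smallest codimension of (the closure of) a point of it; the empty set has
codimension `⊤`. -/
def codim {R : Type*} [CommRing R] (Z : Set (PrimeSpectrum R)) : ℕ∞ :=
  ⨅ p ∈ Z, p.asIdeal.height

/-- The critical locus of `F`: the common zeros of all first partial derivatives of `F`
(the locus where the Jacobi matrix of the single polynomial `F` has rank `< 1`). -/
def criticalLocus (F : MvPolynomial σ k) : Set (PrimeSpectrum (MvPolynomial σ k)) :=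
  PrimeSpectrum.zeroLocus (Set.range fun i => pderiv i F)

/-- The singular locus of the hypersurface `F = 0`: the common zeros of `F` and
of all its first partial derivatives. -/
def singularLocus (F : MvPolynomial σ k) : Set (PrimeSpectrum (MvPolynomial σ k)) :=
  PrimeSpectrum.zeroLocus (insert F (Set.range fun i => pderiv i F))

/-- `c(f)`, the codimension in `V` of the singular locus of `f = 0`. -/
def singCodim (f : MvPolynomial σ k) : ℕ∞ := codim (singularLocus f)

/-- `c'(f)`, the codimension in `V` of the critical locus of `f`. -/
def critCodim (f : MvPolynomial σ k) : ℕ∞ := codim (criticalLocus f)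

/-- The polynomial `f (v + x)` on `V × V`. The coordinates of the first vector `v` are
`X (Sum.inl i)`, those of the second vector `x` are `X (Sum.inr i)`. -/
def addShift (f : MvPolynomial σ k) : MvPolynomial (σ ⊕ σ) k :=
  aeval (fun i => X (Sum.inl i) + X (Sum.inr i)) f

/-- `f^{(m, n)} (v, x)`, the component of bidegree `(m, n)` of `f (v + x)`. -/
def bidegreePart (m n : ℕ) (f : MvPolynomial σ k) : MvPolynomial (σ ⊕ σ) k :=
  weightedHomogeneousComponent
    (Sum.elim (fun _ => ((1, 0) : ℕ × ℕ)) (fun _ => ((0, 1) : ℕ × ℕ))) (m, n) (addShift f)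

/-- The Hessian matrix of `f`, the matrix of the bilinear form `H_f (x)`. -/
def hessian (f : MvPolynomial σ k) : Matrix σ σ (MvPolynomial σ k) :=
  Matrix.of fun i j => pderiv i (pderiv j f)

/-- The coordinates of `H_f (x) v`, as polynomials on `V × V`. -/
def hessianApply [Fintype σ] (f : MvPolynomial σ k) : σ → MvPolynomial (σ ⊕ σ) k :=
  Matrix.mulVec ((hessian f).map (rename Sum.inr)) (fun j => X (Sum.inl j))

/-- `Z^sym_f`, the subvariety of the `(v, x)` in `V × V` with `v ∈ ker H_f (x)`. -/
def symLocus [Fintype σ] (f : MvPolynomial σ k) :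
    Set (PrimeSpectrum (MvPolynomial (σ ⊕ σ) k)) :=
  PrimeSpectrum.zeroLocus (Set.range (hessianApply f))

/-- `g_sym (f)`, the codimension of `Z^sym_f` in `V × V`. -/
def symCodim [Fintype σ] (f : MvPolynomial σ k) : ℕ∞ := codim (symLocus f)

end SymGeom

end

noncomputable section

namespace SymGeom

open MvPolynomial

section Height

variable {A B : Type*} [CommRing A] [CommRing B]

/-- Along an integral extension, heights of primes do not increase on passing to the extension. -/
theorem height_le_height_under_of_isIntegral [Algebra A B] [Algebra.IsIntegral A B]
    (Q : Ideal B) [Q.IsPrime] : Q.height ≤ (Q.under A).height := by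
  have hmono : StrictMono (PrimeSpectrum.comap (algebraMap A B)) := fun I J hIJ => by
    have := I.isPrime
    exact Ideal.IsIntegral.comap_lt_comap (R := A) (I := I.asIdeal) (J := J.asIdeal) hIJ
  have := Order.height_le_height_apply_of_strictMono _ hmono ⟨Q, inferInstance⟩
  rw [← PrimeSpectrum.height_eq_orderHeight, ← PrimeSpectrum.height_eq_orderHeight] at this
  exact this

/-- Going down makes heights of primes not decrease on passing to the extension. -/
theorem height_under_le_height_of_hasGoingDown [Algebra A B] [IsNoetherianRing A]
    [Algebra.HasGoingDown A B] (Q : Ideal B) [Q.IsPrime] : (Q.under A).height ≤ Q.height := by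
  obtain ⟨l, hl, hlen⟩ := (Q.under A).exists_ltSeries_length_eq_height
  have : Q.LiesOver l.last.asIdeal := ⟨by rw [hl]⟩
  obtain ⟨L, hL, hlast, -⟩ := Ideal.exists_ltSeries_of_hasGoingDown l Q
  rw [← hlen, ← hL, (⟨Q, ‹_›⟩ : PrimeSpectrum B).height_eq_orderHeight]
  exact Order.length_le_height hlast.le

/-- A prime `M` of a quotient of `A` dominates a prime `Q` of `A` containing the kernel for which
the heights of `Q` and `M` add up to at most the height of the preimage of `M`. -/
theorem exists_isPrime_height_add_height_le {f : A →+* B} (hf : Function.Surjective f)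
    [IsNoetherianRing B] (M : Ideal B) [M.IsPrime] :
    ∃ Q : Ideal A, Q.IsPrime ∧ RingHom.ker f ≤ Q ∧ Q ≤ M.comap f ∧
      Q.height + M.height ≤ (M.comap f).height := by
  obtain ⟨l, hl, hlen⟩ := M.exists_ltSeries_length_eq_height
  let l' := l.map (PrimeSpectrum.comap f) (RingHom.strictMono_comap_of_surjective hf)
  have hlast : l'.last.asIdeal = M.comap f := by simp [l', hl]
  refine ⟨l'.head.asIdeal, l'.head.isPrime, ?_, ?_, ?_⟩
  · rw [LTSeries.head_map, PrimeSpectrum.comap_asIdeal]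
    exact Ideal.comap_mono bot_le
  · rw [← hlast]
    exact l'.head_le_last
  · rw [← hlen, ← hlast, PrimeSpectrum.height_eq_orderHeight, PrimeSpectrum.height_eq_orderHeight]
    by_cases htop : Order.height l'.head = ⊤
    · have := Order.height_mono l'.head_le_last
      rw [htop, top_le_iff] at this
      rw [this]
      exact le_top
    · obtain ⟨n, hn⟩ := ENat.ne_top_iff_exists.mp htop
      obtain ⟨r, hr, hrlen⟩ := Order.exists_series_of_height_eq_coe _ hn.symm
      have : ((r.smash l' hr).length : ℕ∞) = Order.height l'.head + l.length := by
        rw [← hn, ← hrlen]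
        simp [l']
      rw [← this]
      exact Order.length_le_height (by simp)

theorem height_le_height_comap_of_surjective {f : A →+* B} (hf : Function.Surjective f)
    [IsNoetherianRing B] (M : Ideal B) [M.IsPrime] : M.height ≤ (M.comap f).height := by
  obtain ⟨Q, -, -, -, h⟩ := exists_isPrime_height_add_height_le hf M
  exact le_add_self.trans h

end Height

section Dimension

variable {k : Type*} [Field k]

theorem height_eq_of_isMaximal (n : ℕ) (M : Ideal (MvPolynomial (Fin n) k)) [M.IsMaximal] :
    M.height = n := by
  induction n with
  | zero =>
    let e := (MvPolynomial.isEmptyRingEquiv k (Fin 0))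
    have hF : IsField (MvPolynomial (Fin 0) k) := e.toMulEquiv.isField (Field.toIsField k)
    let := hF.toField
    have : M = ⊥ := (Ideal.eq_bot_or_top M).resolve_right (Ideal.IsMaximal.ne_top ‹_›)
    rw [this, Ideal.height_bot]; rfl
  | succ n ih =>
    let e := (MvPolynomial.finSuccEquiv k n).toRingEquiv
    let N := M.comap (e.symm : Polynomial (MvPolynomial (Fin n) k) →+* MvPolynomial (Fin (n + 1)) k)
    have : N.IsMaximal := Ideal.comap_isMaximal_of_surjective _ e.symm.surjective
    have hN : N.height = M.height := e.symm.height_comap M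
    have hmax : (N.comap Polynomial.C).IsMaximal := Polynomial.isMaximal_comap_C_of_isJacobsonRing N
    have hover : N.LiesOver (N.comap Polynomial.C) := ⟨rfl⟩
    rw [← hN, Polynomial.height_eq_height_add_one (N.comap Polynomial.C) N, ih]
    norm_cast

/-- In a domain of finite type over a field all maximal ideals have the same height, which is
the number of variables of a Noether normalization. -/
theorem height_eq_of_isMaximal_of_noether (k : Type*) [Field k] {n : ℕ} {D : Type*} [CommRing D]
    [IsDomain D] [Algebra (MvPolynomial (Fin n) k) D] [Algebra.IsIntegral (MvPolynomial (Fin n) k) D]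
    [FaithfulSMul (MvPolynomial (Fin n) k) D] (M : Ideal D) [M.IsMaximal] : M.height = n := by
  have hM : (M.under (MvPolynomial (Fin n) k)).IsMaximal :=
    Ideal.isMaximal_comap_of_isIntegral_of_isMaximal M
  refine le_antisymm ?_ ?_
  · exact (height_le_height_under_of_isIntegral M).trans (height_eq_of_isMaximal (k := k) n _).le
  · exact (height_eq_of_isMaximal (k := k) n _).ge.trans
      (height_under_le_height_of_hasGoingDown M)

theorem exists_forall_height_eq_of_isMaximal (k : Type*) [Field k] (D : Type*) [CommRing D]
    [IsDomain D] [Algebra k D] [Algebra.FiniteType k D] :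
    ∃ n : ℕ, ∀ M : Ideal D, M.IsMaximal → M.height = n := by
  obtain ⟨n, g, hg, hint⟩ := exists_integral_inj_algHom_of_fg k D
  algebraize [g.toRingHom]
  have : FaithfulSMul (MvPolynomial (Fin n) k) D := (faithfulSMul_iff_algebraMap_injective _ _).mpr hg
  have : Algebra.IsIntegral (MvPolynomial (Fin n) k) D := ⟨hint⟩
  exact ⟨n, fun M hM => height_eq_of_isMaximal_of_noether k M⟩

/-- Over each maximal ideal the length of a longest chain below it is attained in an integral
extension. -/
theorem exists_isMaximal_height_ge_of_isIntegral {A B : Type*} [CommRing A] [CommRing B]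
    [Algebra A B] [Algebra.IsIntegral A B] [FaithfulSMul A B] [IsNoetherianRing A]
    (m : Ideal A) [m.IsPrime] : ∃ M : Ideal B, M.IsMaximal ∧ m.height ≤ M.height := by
  obtain ⟨l, hl, hlen⟩ := m.exists_ltSeries_length_eq_height
  have hker : RingHom.ker (algebraMap A B) ≤ l.head.asIdeal := by
    rw [(RingHom.injective_iff_ker_eq_bot _).mp (FaithfulSMul.algebraMap_injective A B)]
    exact bot_le
  obtain ⟨P, -, hP, hPl⟩ := Ideal.exists_ideal_over_prime_of_isIntegral
    (S := B) l.head.asIdeal ⊥ hker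
  have : P.LiesOver l.head.asIdeal := ⟨hPl.symm⟩
  obtain ⟨L, hL, -, -⟩ := Ideal.exists_ltSeries_of_hasGoingUp l P
  obtain ⟨M, hM, hle⟩ := Ideal.exists_le_maximal L.last.asIdeal L.last.isPrime.ne_top
  refine ⟨M, hM, ?_⟩
  rw [← hlen, ← hL, (⟨M, hM.isPrime⟩ : PrimeSpectrum B).height_eq_orderHeight]
  exact Order.length_le_height hle

theorem height_comap_le_of_height_ker_eq_one (k : Type*) [Field k] {D E : Type*} [CommRing D]
    [IsDomain D] [CommRing E] [IsDomain E] [Algebra k D] [Algebra k E] [Algebra.FiniteType k D]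
    (f : D →ₐ[k] E) (hf : Function.Surjective f) (h1 : (RingHom.ker f).height = 1)
    (M : Ideal E) [M.IsMaximal] : (M.comap f).height ≤ 1 + M.height := by
  obtain ⟨n, g, hg, hint⟩ := exists_integral_inj_algHom_of_fg k D
  algebraize [g.toRingHom]
  have : FaithfulSMul (MvPolynomial (Fin n) k) D :=
    (faithfulSMul_iff_algebraMap_injective _ _).mpr hg
  have : Algebra.IsIntegral (MvPolynomial (Fin n) k) D := ⟨hint⟩
  have : Algebra.FiniteType k E := Algebra.FiniteType.of_surjective f hf
  have hMD : (M.comap f).IsMaximal := Ideal.comap_isMaximal_of_surjective f hf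
  let h : MvPolynomial (Fin n) k →+* E := (f : D →+* E).comp (algebraMap _ D)
  have hker : RingHom.ker h = (RingHom.ker f).under (MvPolynomial (Fin n) k) := rfl
  have hh : h.IsIntegral :=
    RingHom.IsIntegral.trans _ _ hint ((f : D →+* E).isIntegral_of_surjective hf)
  have hfprime : (RingHom.ker f).IsPrime := RingHom.ker_isPrime f
  have hprime : (RingHom.ker h).IsPrime := RingHom.ker_isPrime h
  have hker1 : (RingHom.ker h).height = 1 := by
    refine le_antisymm ?_ ?_
    · rw [hker, ← h1]
      exact height_under_le_height_of_hasGoingDown _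
    · rw [hker, ← h1]
      exact height_le_height_under_of_isIntegral _
  obtain ⟨x, hx, hxp⟩ := hprime.exists_mem_prime_of_ne_bot (Ideal.ne_bot_of_height_eq_one hker1)
  have hspan : RingHom.ker h = Ideal.span {x} := Ideal.eq_span_singleton_of_height_eq_one hker1 hx hxp
  let M₀ := (M.comap f).under (MvPolynomial (Fin n) k)
  have hM₀ : M₀.IsMaximal := Ideal.isMaximal_comap_of_isIntegral_of_isMaximal _
  have hle : RingHom.ker h ≤ M₀ := Ideal.comap_mono (f := h) bot_le
  have hdrop : M₀.height ≤ (M₀.map (Ideal.Quotient.mk (RingHom.ker h))).height + 1 := by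
    have := Ideal.height_le_height_add_one_of_mem (hle hx)
    rwa [← hspan] at this
  have hmap : (M₀.map (Ideal.Quotient.mk (RingHom.ker h))).IsPrime :=
    Ideal.isPrime_map_quotientMk_of_isPrime hle
  have hlift : h.kerLift.IsIntegral := RingHom.IsIntegral.tower_top (Ideal.Quotient.mk _) _ hh
  algebraize [h.kerLift]
  have : FaithfulSMul (MvPolynomial (Fin n) k ⧸ RingHom.ker h) E :=
    (faithfulSMul_iff_algebraMap_injective _ _).mpr h.kerLift_injective
  obtain ⟨M₁, hM₁, hle₁⟩ := exists_isMaximal_height_ge_of_isIntegral (B := E)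
    (M₀.map (Ideal.Quotient.mk (RingHom.ker h)))
  obtain ⟨s, hs⟩ := exists_forall_height_eq_of_isMaximal k E
  rw [hs M ‹_›, ← hs M₁ hM₁, height_eq_of_isMaximal_of_noether k (n := n) (M.comap f),
    ← height_eq_of_isMaximal n M₀, add_comm]
  exact hdrop.trans (by gcongr)

/-- The dimension formula for a prime `P` in a polynomial ring over a field and a maximal
ideal `M` of the quotient. -/
theorem le_height_add_height_of_isMaximal (n : ℕ) (P : Ideal (MvPolynomial (Fin n) k)) [P.IsPrime]
    (M : Ideal (MvPolynomial (Fin n) k ⧸ P)) [M.IsMaximal] : n ≤ P.height + M.height := by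
  obtain ⟨h, hh⟩ := ENat.ne_top_iff_exists.mp (P.height_ne_top Ideal.IsPrime.ne_top')
  induction h generalizing P with
  | zero =>
    have hmax : (M.comap (Ideal.Quotient.mk P)).IsMaximal :=
      Ideal.comap_isMaximal_of_surjective _ Ideal.Quotient.mk_surjective
    have hP : P = ⊥ := Ideal.height_eq_zero_iff_eq_bot.mp hh.symm
    subst hP
    have := (RingEquiv.quotientBot (MvPolynomial (Fin n) k)).symm.height_comap M
    rw [← height_eq_of_isMaximal n (M.comap (Ideal.Quotient.mk ⊥))]
    exact this.le.trans le_add_self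
  | succ h ih =>
    obtain ⟨P', hlt, hP'⟩ := (Order.coe_lt_height_iff (x := (⟨P, ‹_›⟩ : PrimeSpectrum _))
      (n := h) (by rw [← PrimeSpectrum.height_eq_orderHeight, ← hh]; exact ENat.natCast_lt_top _)).mp (by
        rw [← PrimeSpectrum.height_eq_orderHeight, ← hh]; exact_mod_cast Nat.lt_succ_self h)
    rw [← PrimeSpectrum.height_eq_orderHeight] at hP'
    have := P'.isPrime
    have hle : P'.asIdeal ≤ P := hlt.le
    let f := Ideal.Quotient.factorₐ k hle
    have hf : Function.Surjective f := Ideal.Quotient.factor_surjective hle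
    have hfk : (RingHom.ker f).IsPrime := RingHom.ker_isPrime f
    have hcomap : (RingHom.ker f).comap (Ideal.Quotient.mk P'.asIdeal) = P := by
      ext x
      exact Ideal.Quotient.eq_zero_iff_mem
    have h1 : (RingHom.ker f).height = 1 := by
      refine le_antisymm ?_ ?_
      · obtain ⟨Q, hQ, hkQ, -, hQh⟩ := exists_isPrime_height_add_height_le
          (Ideal.Quotient.mk_surjective (I := P'.asIdeal)) (RingHom.ker f)
        rw [Ideal.mk_ker] at hkQ
        rw [hcomap, ← hh] at hQh
        have h2 := (add_le_add_left (Ideal.height_mono hkQ) (RingHom.ker f).height).trans hQh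
        rw [hP', Nat.cast_add] at h2
        exact (ENat.add_le_add_iff_left (ENat.natCast_ne_top h)).mp h2
      · rw [Order.one_le_iff_ne_zero, Ne, Ideal.height_eq_zero_iff_eq_bot]
        intro h0
        rw [h0, ← RingHom.ker_eq_comap_bot, Ideal.mk_ker] at hcomap
        exact hlt.ne (PrimeSpectrum.ext hcomap)
    have hmax : (M.comap f).IsMaximal := Ideal.comap_isMaximal_of_surjective f hf
    calc (n : ℕ∞) ≤ P'.asIdeal.height + (M.comap f).height := ih P'.asIdeal (M.comap f) hP'.symm
      _ ≤ h + (1 + M.height) := by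
        rw [hP']
        gcongr
        exact height_comap_le_of_height_ker_eq_one k f hf h1 M
      _ = P.height + M.height := by rw [← hh, ← add_assoc]; norm_cast

end Dimension

end SymGeom

namespace SymGeom

open MvPolynomial TensorProduct

section Origin

variable {k : Type*} [Field k] {σ : Type*}

/-- The evaluation of polynomials at the origin. -/
abbrev evalZero (k : Type*) [Field k] (σ : Type*) : MvPolynomial σ k →ₐ[k] k :=
  aeval fun _ => (0 : k)

theorem _root_.AlgHom.surjective_of_field {A : Type*} [CommRing A] [Algebra k A] (f : A →ₐ[k] k) :
    Function.Surjective f := fun c => ⟨algebraMap k A c, by simp⟩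

instance isMaximal_ker_algHom {A : Type*} [CommRing A] [Algebra k A] (f : A →ₐ[k] k) :
    (RingHom.ker f).IsMaximal :=
  RingHom.ker_isMaximal_of_surjective _ f.surjective_of_field

/-- The dimension formula for an affine domain presented as a quotient of a polynomial ring. -/
theorem card_le_height_ker_add_height [Fintype σ] {D : Type*} [CommRing D] [IsDomain D]
    (f : MvPolynomial σ k →+* D) (hf : Function.Surjective f) (M : Ideal D) [M.IsMaximal] :
    (Fintype.card σ : ℕ∞) ≤ (RingHom.ker f).height + M.height := by
  let e := (renameEquiv k (Fintype.equivFin σ)).symm.toRingEquiv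
  let g : MvPolynomial (Fin (Fintype.card σ)) k →+* D :=
    f.comp (e : MvPolynomial (Fin (Fintype.card σ)) k →+* MvPolynomial σ k)
  have hg : Function.Surjective g := hf.comp e.surjective
  have hgp : (RingHom.ker g).IsPrime := RingHom.ker_isPrime g
  let e' := RingHom.quotientKerEquivOfSurjective hg
  have hM : (M.comap (e' : _ ⧸ RingHom.ker g →+* D)).IsMaximal :=
    Ideal.comap_isMaximal_of_surjective _ e'.surjective
  have h := le_height_add_height_of_isMaximal _ (RingHom.ker g) (M.comap (e' : _ →+* D))
  have h1 : (M.comap (e' : _ ⧸ RingHom.ker g →+* D)).height = M.height := e'.height_comap M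
  have h2 : (RingHom.ker g).height = (RingHom.ker f).height := e.height_comap (RingHom.ker f)
  rwa [h1, h2] at h

theorem height_ker_evalZero [Fintype σ] :
    (RingHom.ker (evalZero k σ)).height = (Fintype.card σ : ℕ∞) := by
  let e := (renameEquiv k (Fintype.equivFin σ)).symm.toRingEquiv
  have hM : ((RingHom.ker (evalZero k σ)).comap
      (e : MvPolynomial (Fin (Fintype.card σ)) k →+* MvPolynomial σ k)).IsMaximal :=
    Ideal.comap_isMaximal_of_surjective _ e.surjective
  rw [← height_eq_of_isMaximal _ ((RingHom.ker (evalZero k σ)).comap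
      (e : MvPolynomial (Fin (Fintype.card σ)) k →+* MvPolynomial σ k))]
  exact (e.height_comap _).symm

end Origin

section Intersection

variable {k : Type*} [Field k]

theorem isNoetherianRing_tensorProduct (k A B : Type*) [Field k] [CommRing A] [CommRing B]
    [Algebra k A] [Algebra k B] [Algebra.FiniteType k A] [Algebra.FiniteType k B] :
    IsNoetherianRing (A ⊗[k] B) :=
  have : Algebra.FiniteType k (A ⊗[k] B) := .trans (S := A) inferInstance inferInstance
  Algebra.FiniteType.isNoetherianRing k _

/-- The heights of the ideals of rational points add up at most in a tensor product. -/
theorem height_add_height_le_height_ker_productMap {A B : Type*} [CommRing A] [CommRing B]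
    [Algebra k A] [Algebra k B] [Algebra.FiniteType k A] [Algebra.FiniteType k B]
    (a : A →ₐ[k] k) (b : B →ₐ[k] k) :
    (RingHom.ker a).height + (RingHom.ker b).height ≤
      (RingHom.ker (Algebra.TensorProduct.productMap a b)).height := by
  have : IsNoetherianRing (A ⊗[k] B) := isNoetherianRing_tensorProduct k A B
  have : IsNoetherianRing A := Algebra.FiniteType.isNoetherianRing k _
  have : IsNoetherianRing B := Algebra.FiniteType.isNoetherianRing k _
  set M := RingHom.ker (Algebra.TensorProduct.productMap a b) with hM
  have hover : M.LiesOver (RingHom.ker a) := by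
    refine ⟨?_⟩
    ext x
    simp [hM, Ideal.under, RingHom.mem_ker]
  set I := (RingHom.ker a).map (algebraMap A (A ⊗[k] B)) with hI
  let r : A ⊗[k] B →ₐ[k] B :=
    Algebra.TensorProduct.productMap ((Algebra.ofId k B).comp a) (AlgHom.id k B)
  have hbr : b.comp r = Algebra.TensorProduct.productMap a b := by
    ext x <;> simp [r]
  have hIr : ∀ x ∈ I, r x = 0 := by
    have : I ≤ RingHom.ker r := by
      rw [hI, Ideal.map_le_iff_le_comap]
      intro x hx
      simp [RingHom.mem_ker, r, (RingHom.mem_ker).mp hx]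
    exact this
  let g : A ⊗[k] B ⧸ I →+* B := Ideal.Quotient.lift I (r : A ⊗[k] B →+* B) hIr
  have hg : Function.Surjective g := fun y =>
    ⟨Ideal.Quotient.mk I (1 ⊗ₜ y), (Ideal.Quotient.lift_mk _ _ _).trans (by simp [r])⟩
  have hmap : M.map (Ideal.Quotient.mk I) = (RingHom.ker b).comap g := by
    rw [← Ideal.map_comap_of_surjective _ Ideal.Quotient.mk_surjective ((RingHom.ker b).comap g)]
    congr 1
    ext x
    rw [hM, ← hbr]
    rfl
  rw [Ideal.height_eq_height_add_of_liesOver_of_hasGoingDown (RingHom.ker a) M, ← hI, hmap]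
  gcongr
  exact height_le_height_comap_of_surjective hg _

/-- Reduction to the diagonal: two closed subsets of affine space are intersected by cutting
an ambient scheme with the equations of the diagonal. -/
theorem exists_isPrime_height_add_height_le_of_sup_range_eq_top {σ T : Type*} [Fintype σ]
    [CommRing T] [Algebra k T] [IsNoetherianRing T] (ι₁ ι₂ : MvPolynomial σ k →ₐ[k] T)
    (hι : ι₁.range ⊔ ι₂.range = ⊤) (ε : T →ₐ[k] k) (hε₁ : ε.comp ι₁ = evalZero k σ)
    (hε₂ : ε.comp ι₂ = evalZero k σ) :
    ∃ Q : Ideal (MvPolynomial σ k), Q.IsPrime ∧ RingHom.ker ι₁ ≤ Q ∧ RingHom.ker ι₂ ≤ Q ∧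
      Q ≤ RingHom.ker (evalZero k σ) ∧
      Q.height + (RingHom.ker ε).height ≤ Fintype.card σ + Fintype.card σ := by
  let s : Set T := Set.range fun i => ι₁ (X i) - ι₂ (X i)
  have hs : s ⊆ RingHom.ker ε := by
    rintro _ ⟨i, rfl⟩
    have e₁ := DFunLike.congr_fun hε₁ (X i)
    have e₂ := DFunLike.congr_fun hε₂ (X i)
    simp only [AlgHom.comp_apply] at e₁ e₂
    simp [RingHom.mem_ker, e₁, e₂]
  have hsp : Ideal.span s ≤ RingHom.ker ε := Ideal.span_le.mpr hs
  let π := Ideal.Quotient.mkₐ k (Ideal.span s)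
  let χ : MvPolynomial σ k →ₐ[k] T ⧸ Ideal.span s := π.comp ι₁
  have hχ : χ = π.comp ι₂ := by
    ext i
    exact Ideal.Quotient.eq.mpr (Ideal.subset_span ⟨i, rfl⟩)
  have hχs : Function.Surjective χ := by
    have hle : ι₁.range ⊔ ι₂.range ≤ χ.range.comap π := by
      refine sup_le ?_ ?_
      · rintro _ ⟨x, rfl⟩
        exact ⟨x, rfl⟩
      · rintro _ ⟨x, rfl⟩
        exact ⟨x, DFunLike.congr_fun hχ x⟩
    intro y
    obtain ⟨t, rfl⟩ := Ideal.Quotient.mk_surjective y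
    exact hle (hι ▸ Algebra.mem_top : t ∈ ι₁.range ⊔ ι₂.range)
  let N := (RingHom.ker ε).map (Ideal.Quotient.mk (Ideal.span s))
  have hN : N.IsPrime := Ideal.isPrime_map_quotientMk_of_isPrime hsp
  have hNc : N.comap (χ : MvPolynomial σ k →+* T ⧸ Ideal.span s) = RingHom.ker (evalZero k σ) := by
    have : N.comap (Ideal.Quotient.mk (Ideal.span s)) = RingHom.ker ε := by
      rw [Ideal.comap_map_of_surjective _ Ideal.Quotient.mk_surjective, ← RingHom.ker_eq_comap_bot,
        Ideal.mk_ker, sup_eq_left.mpr hsp]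
    rw [← hε₁]
    change (N.comap (Ideal.Quotient.mk (Ideal.span s))).comap ι₁ = _
    rw [this]
    rfl
  obtain ⟨Q, hQ, hkQ, hQm, hQh⟩ := exists_isPrime_height_add_height_le
    (f := (χ : MvPolynomial σ k →+* T ⧸ Ideal.span s)) hχs N
  rw [hNc] at hQm hQh
  refine ⟨Q, hQ, fun x hx => hkQ ?_, fun x hx => hkQ ?_, hQm, ?_⟩
  · change π (ι₁ x) = 0
    rw [(RingHom.mem_ker).mp hx, map_zero]
  · change χ x = 0
    rw [hχ, AlgHom.comp_apply, (RingHom.mem_ker).mp hx, map_zero]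
  have hcard : s.encard ≤ Fintype.card σ := by
    have := Set.encard_image_le (fun i => ι₁ (X i) - ι₂ (X i)) Set.univ
    rwa [Set.image_univ, Set.encard_univ, ENat.card_eq_coe_fintype_card] at this
  rw [height_ker_evalZero] at hQh
  calc Q.height + (RingHom.ker ε).height ≤ Q.height + (N.height + s.encard) := by
        gcongr
        exact Ideal.height_le_height_add_encard_of_subset s hs
    _ ≤ _ := by rw [← add_assoc]; gcongr

theorem exists_isPrime_height_le_of_surjective_pair {σ A B : Type*} [Fintype σ] [CommRing A]
    [CommRing B] [Algebra k A] [Algebra k B] (f : MvPolynomial σ k →ₐ[k] A)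
    (g : MvPolynomial σ k →ₐ[k] B) (hf : Function.Surjective f) (hg : Function.Surjective g)
    (a : A →ₐ[k] k) (b : B →ₐ[k] k) (ha : a.comp f = evalZero k σ) (hb : b.comp g = evalZero k σ) :
    ∃ Q : Ideal (MvPolynomial σ k), Q.IsPrime ∧ RingHom.ker f ≤ Q ∧ RingHom.ker g ≤ Q ∧
      Q ≤ RingHom.ker (evalZero k σ) ∧
      Q.height + ((RingHom.ker a).height + (RingHom.ker b).height) ≤
        Fintype.card σ + Fintype.card σ := by
  have : Algebra.FiniteType k A := .of_surjective f hf
  have : Algebra.FiniteType k B := .of_surjective g hg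
  have : IsNoetherianRing (A ⊗[k] B) := isNoetherianRing_tensorProduct k A B
  let ι₁ : MvPolynomial σ k →ₐ[k] A ⊗[k] B := Algebra.TensorProduct.includeLeft.comp f
  let ι₂ : MvPolynomial σ k →ₐ[k] A ⊗[k] B := Algebra.TensorProduct.includeRight.comp g
  have hι : ι₁.range ⊔ ι₂.range = ⊤ := by
    rw [eq_top_iff]
    rintro t -
    induction t with
    | zero => exact zero_mem _
    | tmul x y =>
      obtain ⟨x, rfl⟩ := hf x
      obtain ⟨y, rfl⟩ := hg y
      have : f x ⊗ₜ[k] g y = ι₁ x * ι₂ y := by simp [ι₁, ι₂]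
      rw [this]
      exact mul_mem (le_sup_left (a := ι₁.range) ⟨x, rfl⟩) (le_sup_right (a := ι₁.range) ⟨y, rfl⟩)
    | add x y hx hy => exact add_mem hx hy
  obtain ⟨Q, hQ, h₁, h₂, hQm, hQh⟩ := exists_isPrime_height_add_height_le_of_sup_range_eq_top
    ι₁ ι₂ hι (Algebra.TensorProduct.productMap a b)
    (by rw [← AlgHom.comp_assoc, Algebra.TensorProduct.productMap_left, ha])
    (by rw [← hb]; ext i; simp [ι₂])
  refine ⟨Q, hQ, fun x hx => h₁ ?_, fun x hx => h₂ ?_, hQm, le_trans ?_ hQh⟩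
  · simp [ι₁, RingHom.mem_ker, (RingHom.mem_ker).mp hx]
  · simp [ι₂, RingHom.mem_ker, (RingHom.mem_ker).mp hx]
  · gcongr
    exact height_add_height_le_height_ker_productMap a b

/-- Two irreducible closed subsets of affine space which pass through the origin have
an irreducible closed subset through the origin in common whose codimension is at most the sum
of their codimensions. -/
theorem exists_isPrime_height_le_add {σ : Type*} [Fintype σ] (P₁ P₂ : Ideal (MvPolynomial σ k))
    [P₁.IsPrime] [P₂.IsPrime] (h₁ : P₁ ≤ RingHom.ker (evalZero k σ))
    (h₂ : P₂ ≤ RingHom.ker (evalZero k σ)) :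
    ∃ Q : Ideal (MvPolynomial σ k), Q.IsPrime ∧ P₁ ≤ Q ∧ P₂ ≤ Q ∧
      Q ≤ RingHom.ker (evalZero k σ) ∧ Q.height ≤ P₁.height + P₂.height := by
  let ε₁ : MvPolynomial σ k ⧸ P₁ →ₐ[k] k := Ideal.Quotient.liftₐ P₁ (evalZero k σ) h₁
  let ε₂ : MvPolynomial σ k ⧸ P₂ →ₐ[k] k := Ideal.Quotient.liftₐ P₂ (evalZero k σ) h₂
  obtain ⟨Q, hQ, hPQ₁, hPQ₂, hQm, hQh⟩ := exists_isPrime_height_le_of_surjective_pair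
    (Ideal.Quotient.mkₐ k P₁) (Ideal.Quotient.mkₐ k P₂) Ideal.Quotient.mk_surjective
    Ideal.Quotient.mk_surjective ε₁ ε₂ (Ideal.Quotient.liftₐ_comp _ _ _)
    (Ideal.Quotient.liftₐ_comp _ _ _)
  refine ⟨Q, hQ, fun x hx => hPQ₁ (Ideal.Quotient.eq_zero_iff_mem.mpr hx),
    fun x hx => hPQ₂ (Ideal.Quotient.eq_zero_iff_mem.mpr hx), hQm, ?_⟩
  have e₁ := card_le_height_ker_add_height (Ideal.Quotient.mk P₁) Ideal.Quotient.mk_surjective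
    (RingHom.ker ε₁)
  have e₂ := card_le_height_ker_add_height (Ideal.Quotient.mk P₂) Ideal.Quotient.mk_surjective
    (RingHom.ker ε₂)
  rw [Ideal.mk_ker] at e₁ e₂
  have f₁ := (RingHom.ker ε₁).height_ne_top Ideal.IsPrime.ne_top'
  have f₂ := (RingHom.ker ε₂).height_ne_top Ideal.IsPrime.ne_top'
  have f₅ := Q.height_ne_top Ideal.IsPrime.ne_top'
  have f₆ := P₁.height_ne_top Ideal.IsPrime.ne_top'
  have f₇ := P₂.height_ne_top Ideal.IsPrime.ne_top'
  generalize Q.height = q at *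
  generalize P₁.height = p₁ at *
  generalize P₂.height = p₂ at *
  generalize (RingHom.ker ε₁).height = a₁ at *
  generalize (RingHom.ker ε₂).height = a₂ at *
  lift q to ℕ using f₅
  lift p₁ to ℕ using f₆
  lift p₂ to ℕ using f₇
  lift a₁ to ℕ using f₁
  lift a₂ to ℕ using f₂
  norm_cast at *
  omega

/-- Finitely many irreducible closed subsets through the origin of codimension at most `c` have
an irreducible closed subset through the origin in common whose codimension is at most
the number of subsets times `c`. -/
theorem exists_isPrime_height_le_card_mul {σ ι : Type*} [Fintype σ] (s : Finset ι) (c : ℕ∞)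
    (P : ι → Ideal (MvPolynomial σ k)) (hP : ∀ i ∈ s, (P i).IsPrime)
    (hm : ∀ i ∈ s, P i ≤ RingHom.ker (evalZero k σ)) (hc : ∀ i ∈ s, (P i).height ≤ c) :
    ∃ Q : Ideal (MvPolynomial σ k), Q.IsPrime ∧ (∀ i ∈ s, P i ≤ Q) ∧
      Q ≤ RingHom.ker (evalZero k σ) ∧ Q.height ≤ s.card * c := by
  classical
  induction s using Finset.induction_on with
  | empty => exact ⟨⊥, Ideal.isPrime_bot, by simp, bot_le, by simp⟩
  | insert j s hj ih =>
    simp only [Finset.forall_mem_insert] at hP hm hc ⊢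
    obtain ⟨Q, hQ, hPQ, hQm, hQh⟩ := ih hP.2 hm.2 hc.2
    have := hP.1
    obtain ⟨Q', hQ', hj', hQQ', hQm', hQh'⟩ := exists_isPrime_height_le_add (P j) Q hm.1 hQm
    refine ⟨Q', hQ', ⟨hj', fun i hi => (hPQ i hi).trans hQQ'⟩, hQm', hQh'.trans ?_⟩
    rw [Finset.card_insert_of_notMem hj, Nat.cast_add, Nat.cast_one, add_mul, one_mul, add_comm]
    exact add_le_add hQh hc.1

/-- The codimension does not grow on intersecting an irreducible closed subset through the origin
with a linear subspace, given by a surjection of polynomial rings. -/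
theorem exists_isPrime_height_le_of_surjective {σ τ : Type*} [Fintype σ] [Finite τ]
    (f : MvPolynomial σ k →ₐ[k] MvPolynomial τ k) (hf : Function.Surjective f)
    (hker : RingHom.ker f ≤ RingHom.ker (evalZero k σ)) (P : Ideal (MvPolynomial σ k)) [P.IsPrime]
    (hP : P ≤ RingHom.ker (evalZero k σ)) :
    ∃ Q : Ideal (MvPolynomial τ k), Q.IsPrime ∧ P ≤ Q.comap f ∧ Q.height ≤ P.height := by
  have hkp : (RingHom.ker f).IsPrime := RingHom.ker_isPrime f
  obtain ⟨Q', hQ', hPQ, hkQ, -, hh⟩ := exists_isPrime_height_le_add P (RingHom.ker f) hP hker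
  have hQp : (Q'.map f).IsPrime := Ideal.map_isPrime_of_surjective hf hkQ
  have hcomap : (Q'.map f).comap f = Q' := by
    rw [Ideal.comap_map_of_surjective f hf, ← RingHom.ker_eq_comap_bot, sup_eq_left.mpr hkQ]
  refine ⟨Q'.map f, hQp, hPQ.trans hcomap.ge, ?_⟩
  obtain ⟨Q₀, hQ₀, hkQ₀, -, hh₀⟩ := exists_isPrime_height_add_height_le
    (f := (f : MvPolynomial σ k →+* MvPolynomial τ k)) hf (Q'.map f)
  have h1 : (RingHom.ker f).height + (Q'.map f).height ≤ (RingHom.ker f).height + P.height := by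
    calc _ ≤ Q₀.height + (Q'.map f).height := by gcongr; exact hkQ₀
      _ ≤ ((Q'.map f).comap f).height := hh₀
      _ = Q'.height := by rw [hcomap]
      _ ≤ _ := hh.trans_eq (add_comm _ _)
  exact (ENat.add_le_add_iff_left ((RingHom.ker f).height_ne_top Ideal.IsPrime.ne_top')).mp h1

end Intersection

end SymGeom

namespace SymGeom

open MvPolynomial

section Lifting

/-- Among the primes lying over a prime `p` below a given one there is one whose height is at most
that of `p`. -/
theorem exists_isPrime_le_comap_eq_height_le {A B : Type*} [CommRing A] [CommRing B]
    [IsNoetherianRing A] [IsNoetherianRing B] (f : A →+* B) (P : Ideal B) [P.IsPrime] :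
    ∃ Q ≤ P, Q.IsPrime ∧ Q.comap f = P.comap f ∧ Q.height ≤ (P.comap f).height := by
  obtain ⟨s, hs, hcard⟩ := (P.comap f).exists_finset_card_eq_height_of_isNoetherianRing
  have hle : Ideal.span (f '' s) ≤ P := by
    rw [← Ideal.map_span, Ideal.map_le_iff_le_comap]
    exact hs.1.2
  obtain ⟨Q, hQ, hQP⟩ := Ideal.exists_minimalPrimes_le hle
  have hQp := hQ.isPrime
  refine ⟨Q, hQP, hQp, le_antisymm (Ideal.comap_mono hQP) ?_, ?_⟩
  · refine hs.2 ⟨inferInstance, ?_⟩ (Ideal.comap_mono hQP)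
    rw [← Ideal.map_le_iff_le_comap, Ideal.map_span]
    exact hQ.1.2
  · rw [← hcard]
    refine (Ideal.height_le_card_of_mem_minimalPrimes_span (s.finite_toSet.image f) hQ).trans ?_
    have := Set.ncard_image_le (f := f) s.finite_toSet
    rw [Set.ncard_coe_finset] at this
    exact_mod_cast this

variable {k : Type*} [Field k] {σ : Type*}

theorem evalZero_eq_constantCoeff (x : MvPolynomial σ k) : evalZero k σ x = constantCoeff x := by
  simp [evalZero, aeval_zero']

attribute [local instance] MvPolynomial.gradedAlgebra

/-- An irreducible closed subset of the common zero locus of homogeneous polynomials is contained in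
one that contains the origin. -/
theorem exists_isPrime_le_ker_evalZero {ι : Type*} {F : ι → MvPolynomial σ k} {e : ι → ℕ}
    (hF : ∀ i, (F i).IsHomogeneous (e i)) {p : Ideal (MvPolynomial σ k)} (hp : p.IsPrime)
    (hFp : ∀ i, F i ∈ p) :
    ∃ P ≤ p, P.IsPrime ∧ (∀ i, F i ∈ P) ∧ P ≤ RingHom.ker (evalZero k σ) := by
  have hP := hp.homogeneousCore (𝒜 := homogeneousSubmodule σ k)
  refine ⟨(p.homogeneousCore (homogeneousSubmodule σ k)).toIdeal,
    Ideal.toIdeal_homogeneousCore_le _ _, hP, fun i => ?_, fun x hx => ?_⟩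
  · exact Ideal.mem_homogeneousCore_of_homogeneous_of_mem ⟨e i, hF i⟩ (hFp i)
  · have h0 := homogeneousComponent_mem_of_mem
      (p.homogeneousCore (homogeneousSubmodule σ k)).isHomogeneous hx 0
    rw [homogeneousComponent_zero] at h0
    rw [RingHom.mem_ker, evalZero_eq_constantCoeff]
    by_contra hne
    exact hP.ne_top (Ideal.eq_top_of_isUnit_mem _ h0 ((isUnit_iff_ne_zero.mpr hne).map C))

theorem exists_mem_codim_eq {R : Type*} [CommRing R] {Z : Set (PrimeSpectrum R)}
    (hZ : Z.Nonempty) : ∃ p ∈ Z, codim Z = p.asIdeal.height := by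
  have h := csInf_mem (hZ.image fun p => p.asIdeal.height)
  rw [sInf_image] at h
  obtain ⟨p, hp, he⟩ := h
  exact ⟨p, hp, he.symm⟩

theorem codim_le {R : Type*} [CommRing R] {Z : Set (PrimeSpectrum R)} {p : PrimeSpectrum R}
    (hp : p ∈ Z) : codim Z ≤ p.asIdeal.height :=
  iInf₂_le p hp

theorem codim_anti {R : Type*} [CommRing R] {Z Z' : Set (PrimeSpectrum R)} (h : Z ⊆ Z') :
    codim Z' ≤ codim Z :=
  le_iInf₂ fun _ hp => codim_le (h hp)

theorem mem_zeroLocus_range {R ι : Type*} [CommRing R] {F : ι → R} {p : PrimeSpectrum R} :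
    p ∈ PrimeSpectrum.zeroLocus (Set.range F) ↔ ∀ i, F i ∈ p.asIdeal :=
  Set.range_subset_iff

end Lifting

section BaseChange

attribute [local instance] algebraMvPolynomial

variable {k : Type*} [Field k] {σ : Type*} (K : Type*) [Field K] [Algebra k K]

theorem flat_mvPolynomial : Module.Flat (MvPolynomial σ k) (MvPolynomial σ K) :=
  Module.Flat.of_linearEquiv
    (Algebra.IsPushout.equiv k (MvPolynomial σ k) K (MvPolynomial σ K)).symm.toLinearEquiv

/-- The codimension of the zero locus of polynomials does not decrease on extending the base
field. -/
theorem codim_zeroLocus_range_le_codim_map [Finite σ] {ι : Type*} (F : ι → MvPolynomial σ k) :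
    codim (PrimeSpectrum.zeroLocus (Set.range F)) ≤
      codim (PrimeSpectrum.zeroLocus (Set.range fun i => map (algebraMap k K) (F i))) := by
  have := flat_mvPolynomial (k := k) (σ := σ) K
  refine le_iInf₂ fun q hq => ?_
  have h : PrimeSpectrum.comap (algebraMap (MvPolynomial σ k) (MvPolynomial σ K)) q ∈
      PrimeSpectrum.zeroLocus (Set.range F) :=
    mem_zeroLocus_range.mpr fun i => mem_zeroLocus_range.mp hq i
  exact (codim_le h).trans (height_under_le_height_of_hasGoingDown q.asIdeal)

/-- The codimension of the zero locus of polynomials does not increase on extending the base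
field algebraically. -/
theorem codim_map_le_codim_zeroLocus_range [Algebra.IsAlgebraic k K] {ι : Type*}
    (F : ι → MvPolynomial σ k) :
    codim (PrimeSpectrum.zeroLocus (Set.range fun i => map (algebraMap k K) (F i))) ≤
      codim (PrimeSpectrum.zeroLocus (Set.range F)) := by
  refine le_iInf₂ fun p hp => ?_
  have hker : RingHom.ker (algebraMap (MvPolynomial σ k) (MvPolynomial σ K)) ≤ p.asIdeal := by
    rw [(RingHom.injective_iff_ker_eq_bot (algebraMap (MvPolynomial σ k) (MvPolynomial σ K))).mp
      (map_injective (algebraMap k K) (algebraMap k K).injective)]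
    exact bot_le
  obtain ⟨Q, -, hQ, hQp⟩ := Ideal.exists_ideal_over_prime_of_isIntegral
    (S := MvPolynomial σ K) p.asIdeal ⊥ hker
  have h : (⟨Q, hQ⟩ : PrimeSpectrum _) ∈
      PrimeSpectrum.zeroLocus (Set.range fun i => map (algebraMap k K) (F i)) :=
    mem_zeroLocus_range.mpr fun i => by
      have := mem_zeroLocus_range.mp hp i
      rw [← hQp] at this
      exact this
  refine (codim_le h).trans ?_
  rw [← hQp]
  exact height_le_height_under_of_isIntegral Q

end BaseChange

end SymGeom

namespace SymGeom

open MvPolynomial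

section Expansion

variable {k : Type*} [Field k] {σ : Type*}

/-- The polynomial `f (x + t v)` for a scalar `t`. -/
def lineEval (t : k) : MvPolynomial σ k →ₐ[k] MvPolynomial (σ ⊕ σ) k :=
  aeval fun i => X (Sum.inr i) + C t * X (Sum.inl i)

/-- The polynomial `f (x + T v)` as a polynomial in the indeterminate `T`. -/
def lineExpansion : MvPolynomial σ k →ₐ[k] Polynomial (MvPolynomial (σ ⊕ σ) k) :=
  aeval fun i => Polynomial.C (X (Sum.inr i)) + Polynomial.X * Polynomial.C (X (Sum.inl i))

theorem eval_lineExpansion (t : k) (g : MvPolynomial σ k) :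
    (lineExpansion g).eval (C t) = lineEval t g := by
  induction g using MvPolynomial.induction_on with
  | C a => simp [lineExpansion, lineEval, algebraMap_eq, Polynomial.algebraMap_apply]
  | add p q hp hq => simp [hp, hq]
  | mul_X p i hp =>
    rw [map_mul, map_mul, Polynomial.eval_mul, hp]
    simp [lineExpansion, lineEval, mul_comm (C t)]

theorem coeff_zero_lineExpansion (g : MvPolynomial σ k) :
    (lineExpansion g).coeff 0 = rename Sum.inr g := by
  induction g using MvPolynomial.induction_on with
  | C a => simp [lineExpansion]
  | add p q hp hq => simp [hp, hq]
  | mul_X p i hp => simp [lineExpansion, Polynomial.mul_coeff_zero, ← hp]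

theorem coeff_one_lineExpansion [Fintype σ] (g : MvPolynomial σ k) :
    (lineExpansion g).coeff 1 = ∑ j, rename Sum.inr (pderiv j g) * X (Sum.inl j) := by
  classical
  induction g using MvPolynomial.induction_on with
  | C a => simp [lineExpansion]
  | add p q hp hq => simp [hp, hq, add_mul, Finset.sum_add_distrib]
  | mul_X p i hp =>
    have h0 := coeff_zero_lineExpansion p
    have : lineExpansion (p * X i) = lineExpansion p * Polynomial.C (X (Sum.inr i)) +
        lineExpansion p * Polynomial.X * Polynomial.C (X (Sum.inl i)) := by
      simp [lineExpansion, mul_add, mul_assoc]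
    rw [this, Polynomial.coeff_add, Polynomial.coeff_mul_C, Polynomial.coeff_mul_C,
      Polynomial.coeff_mul_X, hp, h0]
    simp_rw [pderiv_mul, map_add, map_mul, rename_X, add_mul, Finset.sum_add_distrib,
      Finset.sum_mul]
    congr 1
    · exact Finset.sum_congr rfl fun j _ => by ring
    · rw [Finset.sum_eq_single i (fun j _ hj => by simp [pderiv_X_of_ne hj.symm]) (by simp)]
      simp

theorem natDegree_aeval_le {B : Type*} [CommRing B] [Algebra k B] (g : MvPolynomial σ k) {n : ℕ}
    (hg : g.totalDegree ≤ n) (φ : σ → Polynomial B) (hφ : ∀ i, (φ i).natDegree ≤ 1) :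
    (aeval φ g).natDegree ≤ n := by
  have h := MvPolynomial.aeval_natDegree_le (map (algebraMap k B) g)
    ((Finset.sup_mono (support_map_subset (algebraMap k B) g)).trans hg) φ hφ
  rwa [aeval_map_algebraMap, mul_one] at h

theorem natDegree_lineExpansion_le (g : MvPolynomial σ k) {n : ℕ} (hg : g.totalDegree ≤ n) :
    (lineExpansion g).natDegree ≤ n :=
  natDegree_aeval_le g hg _ fun i =>
    (Polynomial.natDegree_add_le _ _).trans (max_le (by simp)
      ((Polynomial.natDegree_mul_C_le _ _).trans Polynomial.natDegree_X_le))

theorem pderiv_comm (i j : σ) (f : MvPolynomial σ k) :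
    pderiv i (pderiv j f) = pderiv j (pderiv i f) := by
  classical
  have : ⁅pderiv (R := k) i, pderiv (R := k) j⁆ = 0 := by
    ext l
    simp [Derivation.commutator_apply, pderiv_X, Pi.single_apply, apply_ite]
  have h := DFunLike.congr_fun this f
  rwa [Derivation.commutator_apply, Derivation.zero_apply, sub_eq_zero] at h

theorem hessianApply_eq_coeff [Fintype σ] (f : MvPolynomial σ k) (i : σ) :
    hessianApply f i = (lineExpansion (pderiv i f)).coeff 1 := by
  rw [coeff_one_lineExpansion]
  simp [hessianApply, hessian, Matrix.mulVec, dotProduct, pderiv_comm i]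

end Expansion

end SymGeom

namespace SymGeom

open MvPolynomial

section Bidegree

variable {k : Type*} [Field k] {σ : Type*}

/-- The bidegrees of the coordinates on `V × V`. -/
abbrev bidegreeWeight (σ : Type*) : σ ⊕ σ → ℕ × ℕ :=
  Sum.elim (fun _ => ((1, 0) : ℕ × ℕ)) (fun _ => ((0, 1) : ℕ × ℕ))

theorem weight_bidegreeWeight_add (m : σ ⊕ σ →₀ ℕ) :
    (Finsupp.weight (bidegreeWeight σ) m).1 + (Finsupp.weight (bidegreeWeight σ) m).2 =
      m.degree := by
  induction m using Finsupp.induction_linear with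
  | zero => simp
  | add a b ha hb => rw [map_add, map_add, ← ha, ← hb, Prod.fst_add, Prod.snd_add]; ring
  | single s n => rcases s with s | s <;> simp [Finsupp.weight_single]

/-- The polynomial `F (T v, x)` as a polynomial in the indeterminate `T`. -/
def scaleLeft : MvPolynomial (σ ⊕ σ) k →ₐ[k] Polynomial (MvPolynomial (σ ⊕ σ) k) :=
  aeval (Sum.elim (fun i => Polynomial.X * Polynomial.C (X (Sum.inl i)))
    (fun i => Polynomial.C (X (Sum.inr i))))

theorem scaleLeft_monomial (m : σ ⊕ σ →₀ ℕ) (c : k) :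
    scaleLeft (monomial m c) =
      Polynomial.monomial (Finsupp.weight (bidegreeWeight σ) m).1 (monomial m c) := by
  induction m using Finsupp.induction_linear generalizing c with
  | zero => simp [scaleLeft, Polynomial.algebraMap_apply, algebraMap_eq, ← C_apply]
  | add a b ha hb =>
    rw [← mul_one c, ← monomial_mul, map_mul, ha, hb, Polynomial.monomial_mul_monomial, map_add,
      Prod.fst_add]
  | single s n =>
    rw [← C_mul_X_pow_eq_monomial, map_mul, map_pow]
    rcases s with s | s <;>
      simp [scaleLeft, Finsupp.weight_single, Polynomial.algebraMap_apply, algebraMap_eq, mul_pow,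
        ← Polynomial.C_mul_X_pow_eq_monomial]
    ring

theorem weightedHomogeneousComponent_eq_coeff_scaleLeft {F : MvPolynomial (σ ⊕ σ) k} {a b : ℕ}
    (hF : F.IsHomogeneous (a + b)) :
    weightedHomogeneousComponent (bidegreeWeight σ) (a, b) F = (scaleLeft F).coeff a := by
  classical
  have hsum : (scaleLeft F).coeff a = ∑ m ∈ F.support,
      if (Finsupp.weight (bidegreeWeight σ) m).1 = a then monomial m (coeff m F) else 0 := by
    conv_lhs => rw [F.as_sum, map_sum, Polynomial.finsetSum_coeff]
    simp only [scaleLeft_monomial, Polynomial.coeff_monomial]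
  rw [hsum, weightedHomogeneousComponent_apply, Finset.sum_filter]
  refine Finset.sum_congr rfl fun m hm => if_congr ?_ rfl rfl
  have hd := hF.degree_eq_sum_deg_support hm
  have hw := weight_bidegreeWeight_add m
  rw [Finsupp.degree_apply] at hw
  rw [Prod.ext_iff]
  exact ⟨fun h => h.1, fun h => ⟨h, by omega⟩⟩

theorem scaleLeft_addShift (g : MvPolynomial σ k) : scaleLeft (addShift g) = lineExpansion g := by
  have : (scaleLeft (k := k) (σ := σ)).comp
      (aeval fun i => X (Sum.inl i) + X (Sum.inr i)) = lineExpansion := by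
    ext i : 1
    simp [scaleLeft, lineExpansion, add_comm]
  exact DFunLike.congr_fun this g

theorem pderiv_inl_addShift (i : σ) (f : MvPolynomial σ k) :
    pderiv (Sum.inl i) (addShift f) = addShift (pderiv i f) := by
  classical
  induction f using MvPolynomial.induction_on with
  | C a => simp [addShift]
  | add p q hp hq =>
    simp only [addShift, map_add] at hp hq ⊢
    rw [hp, hq]
  | mul_X p j hp =>
    simp only [addShift, map_mul, pderiv_mul, map_add, aeval_X] at hp ⊢
    rw [hp]
    rcases eq_or_ne j i with rfl | h
    · simp
    · simp [pderiv_X_of_ne h, pderiv_X_of_ne (Sum.inl_injective.ne h)]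

theorem pderiv_inl_weightedHomogeneousComponent (i : σ) (a b : ℕ) (F : MvPolynomial (σ ⊕ σ) k) :
    pderiv (Sum.inl i) (weightedHomogeneousComponent (bidegreeWeight σ) (a + 1, b) F) =
      weightedHomogeneousComponent (bidegreeWeight σ) (a, b) (pderiv (Sum.inl i) F) := by
  classical
  ext m
  simp only [coeff_pderiv, coeff_weightedHomogeneousComponent, map_add, Finsupp.weight_single,
    Sum.elim_inl, one_smul, Prod.ext_iff, Prod.fst_add, Prod.snd_add, add_left_inj, add_zero,
    ite_mul, zero_mul]

theorem IsHomogeneous.addShift {f : MvPolynomial σ k} {n : ℕ} (hf : f.IsHomogeneous n) :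
    (addShift f).IsHomogeneous n := by
  have := hf.aeval (fun i => (X (Sum.inl i) + X (Sum.inr i) : MvPolynomial (σ ⊕ σ) k)) (n := 1)
    fun i => (isHomogeneous_X _ _).add (isHomogeneous_X _ _)
  rwa [one_mul] at this

theorem pderiv_inl_bidegreePart [Fintype σ] {d : ℕ} (hd : 2 ≤ d) {f : MvPolynomial σ k}
    (hf : f.IsHomogeneous d) (i : σ) :
    pderiv (Sum.inl i) (bidegreePart 2 (d - 2) f) = hessianApply f i := by
  have h : (addShift (pderiv i f)).IsHomogeneous (1 + (d - 2)) := by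
    rw [show 1 + (d - 2) = d - 1 by omega]
    exact IsHomogeneous.addShift hf.pderiv
  rw [hessianApply_eq_coeff, ← scaleLeft_addShift,
    ← weightedHomogeneousComponent_eq_coeff_scaleLeft h, ← pderiv_inl_addShift,
    ← pderiv_inl_weightedHomogeneousComponent]
  rfl

end Bidegree

end SymGeom

namespace SymGeom

open MvPolynomial

section Comparison

variable {k : Type*} [Field k] {σ : Type*}

theorem singularLocus_subset_criticalLocus (F : MvPolynomial σ k) :
    singularLocus F ⊆ criticalLocus F :=
  PrimeSpectrum.zeroLocus_anti_mono (Set.subset_insert _ _)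

theorem critCodim_le_singCodim (f : MvPolynomial σ k) : critCodim f ≤ singCodim f :=
  codim_anti (singularLocus_subset_criticalLocus f)

theorem mem_criticalLocus {f : MvPolynomial σ k} {p : PrimeSpectrum (MvPolynomial σ k)} :
    p ∈ criticalLocus f ↔ ∀ i, pderiv i f ∈ p.asIdeal :=
  mem_zeroLocus_range

theorem criticalLocus_map {K : Type*} [Field K] [Algebra k K] (f : MvPolynomial σ k) :
    criticalLocus (map (algebraMap k K) f) =
      PrimeSpectrum.zeroLocus (Set.range fun i => map (algebraMap k K) (pderiv i f)) := by
  simp only [criticalLocus, pderiv_map]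

/-- A polynomial of degree less than `s.card` whose values at the points of `s` lie in a prime has
all its coefficients in this prime. -/
theorem coeff_mem_of_eval_mem {B : Type*} [CommRing B] [Algebra k B] (Q : Ideal B) [Q.IsPrime]
    (p : Polynomial B) (s : Finset k) (hs : p.natDegree < s.card)
    (h : ∀ t ∈ s, p.eval (algebraMap k B t) ∈ Q) (n : ℕ) : p.coeff n ∈ Q := by
  classical
  have hinj : Function.Injective (algebraMap k (B ⧸ Q)) := (algebraMap k (B ⧸ Q)).injective
  have hz : p.map (Ideal.Quotient.mk Q) = 0 := by
    refine Polynomial.eq_zero_of_natDegree_lt_card_of_eval_eq_zero' _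
      (s.image (algebraMap k (B ⧸ Q))) ?_ ?_
    · intro y hy
      obtain ⟨t, ht, rfl⟩ := Finset.mem_image.mp hy
      rw [IsScalarTower.algebraMap_apply k B (B ⧸ Q), Ideal.Quotient.algebraMap_eq,
        Polynomial.eval_map_apply]
      exact Ideal.Quotient.eq_zero_iff_mem.mpr (h t ht)
    · rw [Finset.card_image_of_injective _ hinj]
      exact Polynomial.natDegree_map_le.trans_lt hs
  rw [← Ideal.Quotient.eq_zero_iff_mem, ← Polynomial.coeff_map, hz, Polynomial.coeff_zero]

/-- An irreducible closed subset `P` through the origin of `V` is dominated, under the map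
`(v, x) ↦ x + t v`, by one of `V × V` through the origin of at most the same codimension. -/
theorem exists_isPrime_lineEval [Finite σ] (t : k) (P : Ideal (MvPolynomial σ k)) [P.IsPrime]
    (hP : P ≤ RingHom.ker (evalZero k σ)) :
    ∃ R : Ideal (MvPolynomial (σ ⊕ σ) k), R.IsPrime ∧ (∀ x ∈ P, lineEval t x ∈ R) ∧
      R ≤ RingHom.ker (evalZero k (σ ⊕ σ)) ∧ R.height ≤ P.height := by
  let φ : MvPolynomial σ k →+* MvPolynomial (σ ⊕ σ) k := (lineEval (σ := σ) t).toRingHom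
  let τ : MvPolynomial (σ ⊕ σ) k →ₐ[k] MvPolynomial σ k := aeval (Sum.elim (fun _ => 0) X)
  have hτ : τ.comp (lineEval t) = AlgHom.id k _ := by
    ext i : 1
    simp [τ, lineEval]
  have hτ0 : (evalZero k σ).comp τ = evalZero k (σ ⊕ σ) := by
    ext i
    rcases i with i | i <;> simp [τ]
  have hcomap : (P.comap τ).comap φ = P := by
    ext x
    have : τ (lineEval t x) = x := DFunLike.congr_fun hτ x
    change τ (lineEval t x) ∈ P ↔ x ∈ P
    rw [this]
  obtain ⟨R, hRle, hR, hRc, hRh⟩ := exists_isPrime_le_comap_eq_height_le φ (P.comap τ)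
  rw [hcomap] at hRc hRh
  refine ⟨R, hR, fun x hx => ?_, fun x hx => ?_, hRh⟩
  · rw [← hRc] at hx
    exact hx
  · rw [← hτ0]
    exact hP (hRle hx)

variable [Fintype σ]

theorem hessianApply_eq_sum (f : MvPolynomial σ k) (i : σ) :
    hessianApply f i = ∑ j, rename Sum.inr (pderiv j (pderiv i f)) * X (Sum.inl j) := by
  rw [hessianApply_eq_coeff, coeff_one_lineExpansion]

theorem mem_symLocus {f : MvPolynomial σ k} {p : PrimeSpectrum (MvPolynomial (σ ⊕ σ) k)} :
    p ∈ symLocus f ↔ ∀ i, hessianApply f i ∈ p.asIdeal :=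
  mem_zeroLocus_range

theorem symLocus_map {K : Type*} [Field K] [Algebra k K] (f : MvPolynomial σ k) :
    symLocus (map (algebraMap k K) f) =
      PrimeSpectrum.zeroLocus (Set.range fun i => map (algebraMap k K) (hessianApply f i)) := by
  have (i : σ) : hessianApply (map (algebraMap k K) f) i =
      map (algebraMap k K) (hessianApply f i) := by
    simp [hessianApply_eq_sum, pderiv_map, map_rename]
  simp only [symLocus, ← this]

theorem criticalLocus_bidegreePart_subset {d : ℕ} (hd : 2 ≤ d) {f : MvPolynomial σ k}
    (hf : f.IsHomogeneous d) : criticalLocus (bidegreePart 2 (d - 2) f) ⊆ symLocus f := by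
  intro p hp
  rw [mem_symLocus]
  intro i
  rw [← pderiv_inl_bidegreePart hd hf]
  exact mem_criticalLocus.mp hp _

theorem symCodim_le_mul_height_of_infinite [Infinite k] {d : ℕ} (hd : 2 ≤ d)
    {f : MvPolynomial σ k} (hf : f.IsHomogeneous d) (p : Ideal (MvPolynomial σ k)) (hp : p.IsPrime)
    (hfp : ∀ i, pderiv i f ∈ p) : symCodim f ≤ d * p.height := by
  obtain ⟨P, hPp, hP, hfP, hPm⟩ := exists_isPrime_le_ker_evalZero (fun i => hf.pderiv (i := i))
    hp hfp
  obtain ⟨s, hs⟩ := Infinite.exists_subset_card_eq k d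
  choose R hRp hRP hRm hRh using fun t : k => exists_isPrime_lineEval t P hPm
  obtain ⟨Q, hQ, hRQ, -, hQh⟩ := exists_isPrime_height_le_card_mul s P.height R
    (fun t _ => hRp t) (fun t _ => hRm t) (fun t _ => hRh t)
  have hmem : (⟨Q, hQ⟩ : PrimeSpectrum (MvPolynomial (σ ⊕ σ) k)) ∈ symLocus f := by
    rw [mem_symLocus]
    intro i
    rw [hessianApply_eq_coeff]
    refine coeff_mem_of_eval_mem Q _ s ?_ (fun t ht => ?_) 1
    · have := natDegree_lineExpansion_le _ (hf.pderiv (i := i)).totalDegree_le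
      omega
    · rw [algebraMap_eq, eval_lineExpansion]
      exact hRQ t ht (hRP t _ (hfP i))
  rw [hs] at hQh
  have hh : P.height ≤ p.height := Ideal.height_mono hPp
  exact (codim_le hmem).trans (hQh.trans (by gcongr))

theorem symCodim_le_mul_critCodim_of_infinite [Infinite k] {d : ℕ} (hd : 2 ≤ d)
    {f : MvPolynomial σ k} (hf : f.IsHomogeneous d) : symCodim f ≤ d * critCodim f := by
  rcases (criticalLocus f).eq_empty_or_nonempty with hempty | hne
  · have : critCodim f = ⊤ := by simp [critCodim, codim, hempty]
    rw [this, ENat.mul_top (by exact_mod_cast (by omega : d ≠ 0))]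
    exact le_top
  obtain ⟨p, hp, hpc⟩ := exists_mem_codim_eq hne
  rw [critCodim, hpc]
  exact symCodim_le_mul_height_of_infinite hd hf p.asIdeal p.isPrime (mem_criticalLocus.mp hp)

theorem symCodim_le_mul_critCodim {d : ℕ} (hd : 2 ≤ d) {f : MvPolynomial σ k}
    (hf : f.IsHomogeneous d) : symCodim f ≤ d * critCodim f := by
  let K := AlgebraicClosure k
  have : Infinite K := IsAlgClosed.instInfinite
  calc symCodim f ≤ symCodim (map (algebraMap k K) f) := by
        rw [symCodim, symCodim, symLocus_map]
        exact codim_zeroLocus_range_le_codim_map K _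
    _ ≤ d * critCodim (map (algebraMap k K) f) :=
        symCodim_le_mul_critCodim_of_infinite hd (hf.map _)
    _ ≤ d * critCodim f := by
        gcongr
        rw [critCodim, critCodim, criticalLocus_map]
        exact codim_map_le_codim_zeroLocus_range K _

theorem isHomogeneous_hessianApply {d : ℕ} (hd : 2 ≤ d) {f : MvPolynomial σ k}
    (hf : f.IsHomogeneous d) (i : σ) : (hessianApply f i).IsHomogeneous (d - 1) := by
  rw [hessianApply_eq_sum, show d - 1 = (d - 1 - 1) + 1 by omega]
  exact IsHomogeneous.sum _ _ _ fun j _ =>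
    (hf.pderiv.pderiv.rename_isHomogeneous).mul (isHomogeneous_X _ _)

theorem critCodim_le_symCodim {d : ℕ} (hd : 2 ≤ d) (hk : ((d - 1 : ℕ) : k) ≠ 0)
    {f : MvPolynomial σ k} (hf : f.IsHomogeneous d) : critCodim f ≤ symCodim f := by
  refine le_iInf₂ fun q hq => ?_
  obtain ⟨P, hPq, hP, hfP, hPm⟩ := exists_isPrime_le_ker_evalZero
    (isHomogeneous_hessianApply hd hf) q.isPrime (mem_symLocus.mp hq)
  let δ : MvPolynomial (σ ⊕ σ) k →ₐ[k] MvPolynomial σ k := aeval (Sum.elim X X)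
  have hδ : Function.Surjective δ := by
    have : δ.comp (rename Sum.inl) = AlgHom.id k _ := by
      ext i : 1
      simp [δ]
    exact fun x => ⟨rename Sum.inl x, DFunLike.congr_fun this x⟩
  have hδ0 : (evalZero k σ).comp δ = evalZero k (σ ⊕ σ) := by
    ext i
    rcases i with i | i <;> simp [δ]
  have hker : RingHom.ker δ ≤ RingHom.ker (evalZero k (σ ⊕ σ)) := by
    intro x hx
    rw [← hδ0, RingHom.mem_ker, AlgHom.comp_apply, (RingHom.mem_ker).mp hx, map_zero]
  obtain ⟨Q, hQ, hPQ, hQh⟩ := exists_isPrime_height_le_of_surjective δ hδ hker P hPm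
  have hdiag (i : σ) : δ (hessianApply f i) = C ((d - 1 : ℕ) : k) * pderiv i f := by
    have hr : δ.comp (rename Sum.inr) = AlgHom.id k _ := by
      ext i : 1
      simp [δ]
    have hr' (x : MvPolynomial σ k) : δ (rename Sum.inr x) = x := DFunLike.congr_fun hr x
    rw [hessianApply_eq_sum, map_sum, map_natCast, ← nsmul_eq_mul,
      ← (hf.pderiv (i := i)).sum_X_mul_pderiv]
    refine Finset.sum_congr rfl fun j _ => ?_
    rw [map_mul, hr', mul_comm]
    simp [δ]
  have hmem : (⟨Q, hQ⟩ : PrimeSpectrum (MvPolynomial σ k)) ∈ criticalLocus f := by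
    rw [mem_criticalLocus]
    intro i
    have h : δ (hessianApply f i) ∈ Q := hPQ (hfP i)
    rw [hdiag] at h
    exact (Ideal.unit_mul_mem_iff_mem Q ((isUnit_iff_ne_zero.mpr hk).map C)).mp h
  exact (codim_le hmem).trans (hQh.trans (Ideal.height_mono hPq))

theorem singCodim_le_critCodim {d : ℕ} (hk : (d : k) ≠ 0) {f : MvPolynomial σ k}
    (hf : f.IsHomogeneous d) : singCodim f ≤ critCodim f := by
  refine codim_anti fun p hp => Set.insert_subset ?_ hp
  have h : C (d : k) * f ∈ p.asIdeal := by
    rw [map_natCast, ← nsmul_eq_mul, ← hf.sum_X_mul_pderiv]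
    exact Ideal.sum_mem _ fun i _ => Ideal.mul_mem_left _ _ (mem_criticalLocus.mp hp i)
  exact (Ideal.unit_mul_mem_iff_mem _ ((isUnit_iff_ne_zero.mpr hk).map C)).mp h

end Comparison

end SymGeom

end

theorem proposition3p1 {k : Type*} [Field k] {σ : Type*} [Fintype σ] (d : ℕ) (hd : 2 ≤ d)
    (f : MvPolynomial σ k) (hf : f.IsHomogeneous d) :
    -- (i)
    (SymGeom.singularLocus (SymGeom.bidegreePart 2 (d - 2) f) ⊆ SymGeom.symLocus f ∧
      SymGeom.criticalLocus (SymGeom.bidegreePart 2 (d - 2) f) ⊆ SymGeom.symLocus f) ∧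
    -- (ii)
    (SymGeom.symCodim f ≤ ((d : ℕ∞) + 1) * SymGeom.singCodim f ∧
      SymGeom.symCodim f ≤ ((d : ℕ∞) + 1) * SymGeom.critCodim f) ∧
    (Odd d → ringChar k ≠ 2 →
      SymGeom.symCodim f ≤ (d : ℕ∞) * SymGeom.singCodim f ∧
      SymGeom.symCodim f ≤ (d : ℕ∞) * SymGeom.critCodim f) ∧
    -- (iii)
    (¬ ringChar k ∣ d - 1 →
      SymGeom.critCodim f ≤ SymGeom.symCodim f ∧
      (¬ ringChar k ∣ d → SymGeom.singCodim f ≤ SymGeom.symCodim f)) := by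
  have hcrit := SymGeom.criticalLocus_bidegreePart_subset hd hf
  have hc := SymGeom.symCodim_le_mul_critCodim hd hf
  have hs : SymGeom.symCodim f ≤ d * SymGeom.singCodim f :=
    hc.trans (by gcongr; exact SymGeom.critCodim_le_singCodim f)
  have hd1 : (d : ℕ∞) ≤ d + 1 := le_self_add
  refine ⟨⟨(SymGeom.singularLocus_subset_criticalLocus _).trans hcrit, hcrit⟩,
    ⟨hs.trans (by gcongr), hc.trans (by gcongr)⟩, fun _ _ => ⟨hs, hc⟩, fun h1 => ?_⟩
  have hg := SymGeom.critCodim_le_symCodim hd (mt (ringChar.spec k (d - 1)).mp h1) hf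
  exact ⟨hg, fun h2 =>
    (SymGeom.singCodim_le_critCodim (mt (ringChar.spec k d).mp h2) hf).trans hg⟩
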